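/- Let $d,T$ be nonnegative integers, $C,L>0$, $x_1,\dots,x_T\in\mathbb R^d$, and let $\ell_1,\dots,\ell_T:\mathbb R\to[0,\infty)$ be convex and differentiable. Put $f_t(w)=\ell_t(w^\top x_t)$, $\mathcal K_t=\{w\in\mathbb R^d: |w^\top x_t|\le C\}$ and $\mathcal K=\bigcap_{t=1}^T\mathcal K_t$. Assume: (i) $|\ell_t'(z)|\le L$ for all $|z|\le C$ and all $t$; (ii) there are $\sigma_t\ge 0$ such that for all $t$, all $u\in\mathcal K_t$ and all $w\in\mathcal K$, $$f_t(w)\ \ge\ f_t(u)+\nabla f_t(u)^\top(w-u)+\frac{\sigma_t}{2}\bigl(\nabla f_t(u)^\top(u-w)\bigr)^2 .$$ For parameters $\eta_t\ge0$ consider the algorithm that starts from any $w_1\in\mathcal K_1$ (e.g. $w_1=0$) and, with $g_t=\nabla f_t(w_t)$ and $A_t=\sum_{s=1}^t(\sigma_s+\eta_s)g_sg_s^\top$, iterates for $1\le t<T$ $$u_{t+1}=w_t-A_t^{\dagger}g_t,\qquad w_{t+1}\in\operatorname*{argmin}_{w\in\mathcal K_{t+1}}\|w-u_{t+1}\|_{A_t},$$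 where $A^\dagger$ is the Moore–Penrose pseudoinverse, $\|v\|_A=\sqrt{v^\top Av}$, and any minimizer may be chosen. Its regret is $R_T=\sup_{w\in\mathcal K}\sum_{t=1}^T\bigl(f_t(w_t)-f_t(w)\bigr)$. Let $\widehat A_t=\sum_{s=1}^t g_sg_s^\top$, let $r$ be the rank of $\widehat A_T$, let $\lambda^*$ be the smallest of all nonzero eigenvalues of $\widehat A_1,\dots,\widehat A_T$, and put $$B=r+\frac{(1+r)r}{2}\ln\left(1+\frac{2\sum_{t=1}^T\|g_t\|_2^2}{(1+r)r\lambda^*}\right),$$ with $B=0$ if $r=0$. 1. If $\sigma_t=0$ for all $t$ and $\eta_t=\frac1{CL}\sqrt{d/t}$, then $$R_T\le\frac{CL}{2}\sqrt{\frac Td}\,B+4CL\sqrt{Td}$$ (where $\sqrt{T/d}$ is read as $0$ if $d=0$). 2. If $\sigma_t\ge\sigma>0$ for all $t$ and $\eta_t=0$ for all $t$, then $$R_T\le\frac1{2\sigma}\,B .$$ -/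

import Mathlib

noncomputable section

namespace OnlineNewton

open Matrix

/-- The four Penrose equations: `P` is the Moore-Penrose pseudoinverse of the real matrix `A`. -/
structure IsMoorePenrose {d : ℕ} (A P : Matrix (Fin d) (Fin d) ℝ) : Prop where
  mul_mul_self : A * P * A = A
  self_mul_mul : P * A * P = P
  symm_left : (A * P)ᵀ = A * P
  symm_right : (P * A)ᵀ = P * A

theorem IsMoorePenrose.unique {d : ℕ} {A P Q : Matrix (Fin d) (Fin d) ℝ}
    (hP : IsMoorePenrose A P) (hQ : IsMoorePenrose A Q) : P = Q := by
  have h1 : A * P = A * Q := by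
    calc A * P = (A * P)ᵀ := hP.symm_left.symm
      _ = ((A * Q) * (A * P))ᵀ := by rw [← mul_assoc, hQ.mul_mul_self]
      _ = (A * P) * (A * Q) := by rw [transpose_mul, hP.symm_left, hQ.symm_left]
      _ = A * Q := by rw [← mul_assoc, hP.mul_mul_self]
  have h2 : P * A = Q * A := by
    calc P * A = (P * A)ᵀ := hP.symm_right.symm
      _ = ((P * A) * (Q * A))ᵀ := by
          rw [mul_assoc P A, ← mul_assoc A Q, hQ.mul_mul_self]
      _ = (Q * A) * (P * A) := by rw [transpose_mul, hP.symm_right, hQ.symm_right]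
      _ = Q * A := by rw [mul_assoc Q A, ← mul_assoc A P, hP.mul_mul_self]
  calc P = P * A * P := hP.self_mul_mul.symm
    _ = Q * (A * P) := by rw [h2, mul_assoc]
    _ = Q * A * Q := by rw [h1, mul_assoc]
    _ = Q := hQ.self_mul_mul

theorem exists_isMoorePenrose_of_isHermitian {d : ℕ} (A : Matrix (Fin d) (Fin d) ℝ)
    (hA : A.IsHermitian) : ∃ P : Matrix (Fin d) (Fin d) ℝ, IsMoorePenrose A P ∧ Pᵀ = P := by
  obtain ⟨U, D, hU, hAD⟩ : ∃ (U : Matrix (Fin d) (Fin d) ℝ) (D : Fin d → ℝ),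
      Uᵀ * U = 1 ∧ A = U * diagonal D * Uᵀ := by
    refine ⟨hA.eigenvectorUnitary, hA.eigenvalues, ?_, ?_⟩
    · have := Unitary.coe_star_mul_self hA.eigenvectorUnitary
      simpa [star_eq_conjTranspose, conjTranspose_eq_transpose_of_trivial] using this
    · have := hA.spectral_theorem
      rw [Unitary.conjStarAlgAut_apply] at this
      simpa [star_eq_conjTranspose, conjTranspose_eq_transpose_of_trivial,
        Function.comp_def] using this
  have key : ∀ E F : Fin d → ℝ, (U * diagonal E * Uᵀ) * (U * diagonal F * Uᵀ)
      = U * diagonal (fun i => E i * F i) * Uᵀ := by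
    intro E F
    calc (U * diagonal E * Uᵀ) * (U * diagonal F * Uᵀ)
        = U * diagonal E * (Uᵀ * U) * diagonal F * Uᵀ := by simp only [mul_assoc]
      _ = _ := by rw [hU, mul_one, mul_assoc U, diagonal_mul_diagonal]
  have ht : ∀ E : Fin d → ℝ, (U * diagonal E * Uᵀ)ᵀ = U * diagonal E * Uᵀ := by
    intro E
    simp [transpose_mul, mul_assoc]
  refine ⟨U * diagonal (fun i => (D i)⁻¹) * Uᵀ, ⟨?_, ?_, ?_, ?_⟩, ht _⟩
  · rw [hAD, key, key]
    congr 3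
    funext i
    exact mul_inv_mul_cancel (D i)
  · rw [hAD, key, key]
    congr 3
    funext i
    by_cases h : D i = 0 <;> simp [h]
  · rw [hAD, key, ht]
  · rw [hAD, key, ht]

theorem exists_isMoorePenrose {d : ℕ} (A : Matrix (Fin d) (Fin d) ℝ) :
    ∃ P : Matrix (Fin d) (Fin d) ℝ, IsMoorePenrose A P := by
  have hH : (Aᵀ * A).IsHermitian := by
    simpa [conjTranspose_eq_transpose_of_trivial] using isHermitian_conjTranspose_mul_self A
  obtain ⟨P, hP, hPt⟩ := exists_isMoorePenrose_of_isHermitian (Aᵀ * A) hH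
  have hz : A * P * (Aᵀ * A) = A := by
    have h0 : (A * P * (Aᵀ * A) - A)ᵀ * (A * P * (Aᵀ * A) - A) = 0 := by
      have h1 : Aᵀ * (A * P * (Aᵀ * A) - A) = 0 := by
        have := hP.mul_mul_self
        rw [mul_sub, sub_eq_zero]
        simpa only [mul_assoc] using this
      have h2 : (A * P * (Aᵀ * A) - A)ᵀ = (P * (Aᵀ * A) - 1)ᵀ * Aᵀ := by
        rw [← transpose_mul, mul_sub, mul_one, mul_assoc A P]
      rw [h2, mul_assoc, h1, mul_zero]
    rw [← conjTranspose_eq_transpose_of_trivial, conjTranspose_mul_self_eq_zero, sub_eq_zero] at h0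
    exact h0
  refine ⟨P * Aᵀ, ⟨?_, ?_, ?_, ?_⟩⟩
  · simpa only [mul_assoc] using hz
  · have := congrArg (· * Aᵀ) hP.self_mul_mul
    simpa only [mul_assoc] using this
  · simp [transpose_mul, hPt, mul_assoc]
  · have := hP.symm_right
    simpa only [mul_assoc] using this

/-- The Moore-Penrose pseudoinverse of a real square matrix. -/
def pinv {d : ℕ} (A : Matrix (Fin d) (Fin d) ℝ) : Matrix (Fin d) (Fin d) ℝ :=
  (exists_isMoorePenrose A).choose

theorem pinv_spec {d : ℕ} (A : Matrix (Fin d) (Fin d) ℝ) : IsMoorePenrose A (pinv A) :=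
  (exists_isMoorePenrose A).choose_spec

/-- The seminorm `‖v‖_A = √(vᵀ A v)`. -/
def matNorm {d : ℕ} (A : Matrix (Fin d) (Fin d) ℝ) (v : EuclideanSpace ℝ (Fin d)) : ℝ :=
  √(inner ℝ v (toEuclideanLin A v))

/-- The loss of round `t` as a function of the weight vector, `f_t(w) = ℓ_t(wᵀ x_t)`. -/
def roundLoss {d : ℕ} (x : ℕ → EuclideanSpace ℝ (Fin d)) (ℓ : ℕ → ℝ → ℝ) (t : ℕ)
    (w : EuclideanSpace ℝ (Fin d)) : ℝ :=
  ℓ t (inner ℝ w (x t))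

/-- `𝒦_t`: the weight vectors whose prediction on `x_t` is bounded by `C`. -/
def slab {d : ℕ} (C : ℝ) (x : ℕ → EuclideanSpace ℝ (Fin d)) (t : ℕ) :
    Set (EuclideanSpace ℝ (Fin d)) :=
  {w | |inner ℝ w (x t)| ≤ C}

/-- `𝒦 = ⋂_{t = 1, …, T} 𝒦_t`. -/
def comparators {d : ℕ} (C : ℝ) (x : ℕ → EuclideanSpace ℝ (Fin d)) (T : ℕ) :
    Set (EuclideanSpace ℝ (Fin d)) :=
  ⋂ t ∈ Finset.Icc 1 T, slab C x t

/-- The regret `R_T(v)` of the iterates `w_1, …, w_T` to the comparator `v`. -/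
def regretTo {d : ℕ} (x : ℕ → EuclideanSpace ℝ (Fin d)) (ℓ : ℕ → ℝ → ℝ) (T : ℕ)
    (w : ℕ → EuclideanSpace ℝ (Fin d)) (v : EuclideanSpace ℝ (Fin d)) : ℝ :=
  ∑ t ∈ Finset.Icc 1 T, roundLoss x ℓ t (w t) - ∑ t ∈ Finset.Icc 1 T, roundLoss x ℓ t v

/-- The regret `R_T = sup_{v ∈ 𝒦} R_T(v)`, an extended real number. -/
def regret {d : ℕ} (C : ℝ) (x : ℕ → EuclideanSpace ℝ (Fin d)) (ℓ : ℕ → ℝ → ℝ) (T : ℕ)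
    (w : ℕ → EuclideanSpace ℝ (Fin d)) : EReal :=
  ⨆ v ∈ comparators C x T, ((regretTo x ℓ T w v : ℝ) : EReal)

/-- The gradients `g_t = ∇f_t(w_t)` along the iterates. -/
def iterGrad {d : ℕ} (x : ℕ → EuclideanSpace ℝ (Fin d)) (ℓ : ℕ → ℝ → ℝ)
    (w : ℕ → EuclideanSpace ℝ (Fin d)) (t : ℕ) : EuclideanSpace ℝ (Fin d) :=
  gradient (roundLoss x ℓ t) (w t)

/-- `∑_{s = 1}^t c_s g_s g_sᵀ`. -/
def gram {d : ℕ} (c : ℕ → ℝ) (g : ℕ → EuclideanSpace ℝ (Fin d)) (t : ℕ) :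
    Matrix (Fin d) (Fin d) ℝ :=
  ∑ s ∈ Finset.Icc 1 t, c s • vecMulVec (g s) (g s)

/-- The assumptions on the loss functions `ℓ_1, …, ℓ_T`: they are convex, differentiable and
nonnegative, have slope at most `L` on `[-C, C]`, and satisfy the curvature inequality. -/
structure LossAssumptions {d : ℕ} (C L : ℝ) (T : ℕ) (x : ℕ → EuclideanSpace ℝ (Fin d))
    (ℓ : ℕ → ℝ → ℝ) (σ : ℕ → ℝ) : Prop where
  nonneg : ∀ t ∈ Finset.Icc 1 T, ∀ z, 0 ≤ ℓ t z
  convex : ∀ t ∈ Finset.Icc 1 T, ConvexOn ℝ Set.univ (ℓ t)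
  differentiable : ∀ t ∈ Finset.Icc 1 T, Differentiable ℝ (ℓ t)
  lipschitz : ∀ t ∈ Finset.Icc 1 T, ∀ z, |z| ≤ C → |deriv (ℓ t) z| ≤ L
  sigma_nonneg : ∀ t ∈ Finset.Icc 1 T, 0 ≤ σ t
  curvature : ∀ t ∈ Finset.Icc 1 T, ∀ u ∈ slab C x t, ∀ w ∈ comparators C x T,
    roundLoss x ℓ t u + inner ℝ (gradient (roundLoss x ℓ t) u) (w - u)
      + σ t / 2 * (inner ℝ (gradient (roundLoss x ℓ t) u) (u - w)) ^ 2 ≤ roundLoss x ℓ t w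

/-- `w_1, …, w_T` are iterates of the truly invariant online Newton algorithm: `w_1 ∈ 𝒦_1`, and for
`1 ≤ t < T`, with `A_t = ∑_{s ≤ t} (σ_s + η_s) g_s g_sᵀ` and `u_{t+1} = w_t - A_t^† g_t`, the
vector `w_{t+1}` is a (not necessarily unique) minimizer of `‖w - u_{t+1}‖_{A_t}` over
`𝒦_{t+1}`. -/
structure IsInvariantRun {d : ℕ} (C : ℝ) (T : ℕ) (x : ℕ → EuclideanSpace ℝ (Fin d))
    (ℓ : ℕ → ℝ → ℝ) (σ η : ℕ → ℝ) (w : ℕ → EuclideanSpace ℝ (Fin d)) : Prop where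
  init : 1 ≤ T → w 1 ∈ slab C x 1
  mem : ∀ t, 1 ≤ t → t < T → w (t + 1) ∈ slab C x (t + 1)
  argmin : ∀ t, 1 ≤ t → t < T →
    IsMinOn
      (fun v => matNorm (gram (fun s => σ s + η s) (iterGrad x ℓ w) t)
        (v - (w t - toEuclideanLin (pinv (gram (fun s => σ s + η s) (iterGrad x ℓ w) t))
          (iterGrad x ℓ w t))))
      (slab C x (t + 1)) (w (t + 1))

/-- `λ*`: the least among all nonzero eigenvalues of the matrices `∑_{s ≤ t} g_s g_sᵀ`,
`t = 1, …, T` (and `0` if all these matrices vanish). -/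
def lambdaStar {d : ℕ} (T : ℕ) (g : ℕ → EuclideanSpace ℝ (Fin d)) : ℝ :=
  sInf {μ : ℝ | μ ≠ 0 ∧ ∃ t ∈ Finset.Icc 1 T,
    Module.End.HasEigenvalue (toEuclideanLin (gram (fun _ => 1) g t)) μ}

/-- The rank `r` of `∑_{s ≤ T} g_s g_sᵀ`. -/
def finalRank {d : ℕ} (T : ℕ) (g : ℕ → EuclideanSpace ℝ (Fin d)) : ℕ :=
  (gram (fun _ => 1) g T).rank

/-- `r + ((1 + r) r / 2) ln (1 + 2 ∑_{t ≤ T} ‖g_t‖² / ((1 + r) r λ*))`. -/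
def logTerm {d : ℕ} (T : ℕ) (g : ℕ → EuclideanSpace ℝ (Fin d)) : ℝ :=
  (finalRank T g : ℝ) + (1 + (finalRank T g : ℝ)) * (finalRank T g : ℝ) / 2 *
    Real.log (1 + 2 * (∑ t ∈ Finset.Icc 1 T, ‖g t‖ ^ 2) /
      ((1 + (finalRank T g : ℝ)) * (finalRank T g : ℝ) * lambdaStar T g))

end OnlineNewton

end

open OnlineNewton

open Matrix hiding gram

/-! Put c_t = σ_t + η_t and p_t = A_t^† g_t. Tracking the squared A_t-distance to a comparator v
through Newton steps and projections, which do not increase it since v lies in every slab, gives 2 ∑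
⟨g_t, w_t - v⟩ ≤ ∑ c_t ⟨g_t, w_t - v⟩² + ∑ ⟨g_t, p_t⟩ (`two_mul_sum_inner_le`). In the quadratic sum
the curvature inequality absorbs the σ part, and the η part costs at most 2 (C L)² η_t per round,
because |⟨g_t, w_t - v⟩| ≤ 2 C L.

If c_t ≥ κ, then κ ∑ ⟨g_t, p_t⟩ is at most the sum of the leverages of g_t in Â_t. These are used
only in the variational form 2 ⟨g_t, y⟩ - yᵀ Â_t y with y arbitrary, so pseudoinverses of different
matrices are never compared.

The leverages are summed in groups of rounds with equal rank k of Â_t (`sum_leverage_le_logTerm`).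
The first round of a group contributes at most 1. The later gradients stay in the range of the Gram
matrix of that first round; rescaling it to the identity on its range reduces them to the usual
log-determinant potential, which yields k ln(1 + Q_k / (k λ*)) with Q_k the sum of ‖g_t‖² over the
group. Concavity of ln combines k = 1, …, r. -/

/-! ### Log-determinant potential and concavity of the logarithm -/

theorem Matrix.det_add_vecMulVec_self {ι : Type*} [Fintype ι] [DecidableEq ι]
    {N : Matrix ι ι ℝ} (hN : IsUnit N.det) (h : ι → ℝ) :
    (N + vecMulVec h h).det = N.det * (1 + h ⬝ᵥ (N⁻¹ *ᵥ h)) := by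
  have := det_add_replicateCol_mul_replicateRow (ι := Unit) hN h h
  rw [← vecMulVec_eq Unit h h] at this
  rw [this, Matrix.mul_assoc (replicateRow Unit h), ← replicateCol_mulVec,
    det_one_add_mul_comm, det_one_add_replicateCol_mul_replicateRow]

theorem Matrix.posDef_add_vecMulVec_self {ι : Type*} [Fintype ι]
    {N : Matrix ι ι ℝ} (hN : N.PosDef) (h : ι → ℝ) : (N + vecMulVec h h).PosDef := by
  have := posSemidef_vecMulVec_self_star h
  rw [star_trivial] at this
  exact hN.add_posSemidef this

/-- The leverage score of `h` in `N + h hᵀ` is at most the increase of the log-determinant. -/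
theorem Matrix.PosDef.two_mul_dotProduct_sub_le {ι : Type*} [Fintype ι] [DecidableEq ι]
    {N : Matrix ι ι ℝ} (hN : N.PosDef) (h z : ι → ℝ) :
    2 * (h ⬝ᵥ z) - z ⬝ᵥ ((N + vecMulVec h h) *ᵥ z) ≤
      Real.log (N + vecMulVec h h).det - Real.log N.det := by
  have hdet := hN.det_pos
  set q := N⁻¹ *ᵥ h with hq
  set a := h ⬝ᵥ q with ha
  have hNq : N *ᵥ q = h := by
    rw [hq, mulVec_mulVec, mul_nonsing_inv _ hdet.ne'.isUnit, one_mulVec]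
  have hT : Nᵀ = N := by
    rw [← conjTranspose_eq_transpose_of_trivial]; exact hN.isHermitian
  have ha0 : 0 ≤ a := by
    have := hN.inv.posSemidef.dotProduct_mulVec_nonneg h
    simpa using this
  have hqz : q ⬝ᵥ (N *ᵥ z) = h ⬝ᵥ z := by
    rw [dotProduct_mulVec, ← mulVec_transpose, hT, hNq]
  have hz : z ⬝ᵥ ((N + vecMulVec h h) *ᵥ z) = z ⬝ᵥ (N *ᵥ z) + (h ⬝ᵥ z) ^ 2 := by
    rw [add_mulVec, dotProduct_add, vecMulVec_mulVec]
    simp [dotProduct_comm z h]; ring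
  -- The left side is maximal at z = τ q, with value 1 - τ = a / (1 + a). The gap is the sum of the
  -- squared N-norm of z - τ q and (h ⬝ᵥ z - (1 - τ))².
  set τ := (1 + a)⁻¹ with hτ
  have hτa : τ * (1 + a) = 1 := inv_mul_cancel₀ (by positivity)
  have hpos : 0 ≤ z ⬝ᵥ (N *ᵥ z) - 2 * τ * (h ⬝ᵥ z) + τ ^ 2 * a := by
    have := hN.posSemidef.dotProduct_mulVec_nonneg (z - τ • q)
    rw [star_trivial, mulVec_sub, mulVec_smul, hNq] at this
    simp only [sub_dotProduct, dotProduct_sub, smul_dotProduct, dotProduct_smul, hqz,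
      smul_eq_mul, dotProduct_comm z h, dotProduct_comm q h, ← ha] at this
    linarith
  have hlog : 1 - τ ≤ Real.log (1 + a) := Real.one_sub_inv_le_log_of_pos (by positivity)
  rw [det_add_vecMulVec_self hdet.ne'.isUnit, Real.log_mul hdet.ne' (by positivity), hz]
  have e : τ ^ 2 * a = τ * (1 - τ) := by linear_combination τ * hτa
  nlinarith [sq_nonneg (h ⬝ᵥ z - (1 - τ))]

theorem Real.log_le_log_add_div_sub_one {a b : ℝ} (ha : 0 < a) (hb : 0 < b) :
    Real.log a ≤ Real.log b + a / b - 1 := by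
  have := Real.log_le_sub_one_of_pos (div_pos ha hb)
  rw [Real.log_div ha.ne' hb.ne'] at this
  linarith

/-- The tangent to ln at b dominates the logarithm of every eigenvalue. Taking b to be the mean
eigenvalue gives AM-GM. -/
theorem Matrix.PosDef.log_det_le {ι : Type*} [Fintype ι] [DecidableEq ι]
    {N : Matrix ι ι ℝ} (hN : N.PosDef) {b : ℝ} (hb : 0 < b) :
    Real.log N.det ≤ Fintype.card ι * Real.log b + N.trace / b - Fintype.card ι := by
  have h1 := hN.isHermitian.det_eq_prod_eigenvalues
  have h2 := hN.isHermitian.trace_eq_sum_eigenvalues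
  simp only [RCLike.ofReal_real_eq_id, id_eq] at h1 h2
  have hpos : ∀ i, 0 < hN.isHermitian.eigenvalues i := hN.eigenvalues_pos
  rw [h1, h2, Real.log_prod fun i _ => (hpos i).ne']
  calc _ ≤ ∑ i, (Real.log b + hN.isHermitian.eigenvalues i / b - 1) :=
        Finset.sum_le_sum fun i _ => Real.log_le_log_add_div_sub_one (hpos i) hb
    _ = _ := by simp [Finset.sum_add_distrib, Finset.sum_div]

theorem posDef_one_add_sum_vecMulVec {ι : Type*} [Fintype ι] [DecidableEq ι]
    (h : ℕ → ι → ℝ) (S : Finset ℕ) :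
    (1 + ∑ s ∈ S, vecMulVec (h s) (h s) : Matrix ι ι ℝ).PosDef := by
  induction S using Finset.induction_on with
  | empty => simpa using PosDef.one
  | insert a S ha ih =>
    rw [Finset.sum_insert ha, add_left_comm, add_comm]
    exact posDef_add_vecMulVec_self ih _

theorem dotProduct_one_add_sum_vecMulVec_mulVec {ι : Type*} [Fintype ι] [DecidableEq ι]
    (h : ℕ → ι → ℝ) (S : Finset ℕ) (z : ι → ℝ) :
    z ⬝ᵥ ((1 + ∑ s ∈ S, vecMulVec (h s) (h s) : Matrix ι ι ℝ) *ᵥ z) =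
      z ⬝ᵥ z + ∑ s ∈ S, (h s ⬝ᵥ z) ^ 2 := by
  rw [add_mulVec, one_mulVec, dotProduct_add, sum_mulVec, dotProduct_sum]
  congr 1
  refine Finset.sum_congr rfl fun s _ => ?_
  rw [vecMulVec_mulVec]
  simp [dotProduct_comm z (h s)]; ring

/-- Adding the indices in increasing order leaves the earlier summands untouched, so the
log-determinant increments telescope from ln det 1 = 0. -/
theorem sum_leverage_le_log_det {ι : Type*} [Fintype ι] [DecidableEq ι]
    (h z : ℕ → ι → ℝ) (S : Finset ℕ) :
    ∑ t ∈ S, (2 * (h t ⬝ᵥ z t) - z t ⬝ᵥ z t - ∑ s ∈ S with s ≤ t, (h s ⬝ᵥ z t) ^ 2) ≤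
      Real.log (1 + ∑ s ∈ S, vecMulVec (h s) (h s) : Matrix ι ι ℝ).det := by
  induction S using Finset.induction_on_max with
  | empty => simp
  | insert a S hmax ih =>
    have ha : a ∉ S := fun h => lt_irrefl _ (hmax a h)
    have e1 : ∀ t ∈ S, ({s ∈ insert a S | s ≤ t} : Finset ℕ) = {s ∈ S | s ≤ t} := by
      intro t ht
      rw [Finset.filter_insert, if_neg (not_le.2 (hmax t ht))]
    have e2 : ({s ∈ insert a S | s ≤ a} : Finset ℕ) = insert a S := by
      refine Finset.filter_true_of_mem fun s hs => ?_
      rcases Finset.mem_insert.1 hs with rfl | hs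
      · exact le_rfl
      · exact (hmax s hs).le
    have e4 : ∀ t ∈ S,
        2 * (h t ⬝ᵥ z t) - z t ⬝ᵥ z t - ∑ s ∈ insert a S with s ≤ t, (h s ⬝ᵥ z t) ^ 2 =
          2 * (h t ⬝ᵥ z t) - z t ⬝ᵥ z t - ∑ s ∈ S with s ≤ t, (h s ⬝ᵥ z t) ^ 2 :=
      fun t ht => by rw [e1 t ht]
    rw [Finset.sum_insert ha, e2, Finset.sum_congr rfl e4]
    have key := (posDef_one_add_sum_vecMulVec h S).two_mul_dotProduct_sub_le (h a) (z a)
    have e3 : (1 + ∑ s ∈ S, vecMulVec (h s) (h s) : Matrix ι ι ℝ) + vecMulVec (h a) (h a) =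
        1 + ∑ s ∈ insert a S, vecMulVec (h s) (h s) := by
      rw [Finset.sum_insert ha]; abel
    rw [e3, dotProduct_one_add_sum_vecMulVec_mulVec] at key
    linarith

theorem sum_leverage_le {ι : Type*} [Fintype ι] [DecidableEq ι] [Nonempty ι]
    (h z : ℕ → ι → ℝ) (S : Finset ℕ) :
    ∑ t ∈ S, (2 * (h t ⬝ᵥ z t) - z t ⬝ᵥ z t - ∑ s ∈ S with s ≤ t, (h s ⬝ᵥ z t) ^ 2) ≤
      Fintype.card ι * Real.log (1 + (∑ s ∈ S, h s ⬝ᵥ h s) / Fintype.card ι) := by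
  refine (sum_leverage_le_log_det h z S).trans ?_
  have hk : (0 : ℝ) < Fintype.card ι := by exact_mod_cast Fintype.card_pos
  have hS : 0 ≤ ∑ s ∈ S, h s ⬝ᵥ h s :=
    Finset.sum_nonneg fun s _ => Finset.sum_nonneg fun i _ => mul_self_nonneg _
  -- This tangent point is the trace divided by the size, so the linear terms of `log_det_le`
  -- cancel.
  have hb : 0 < 1 + (∑ s ∈ S, h s ⬝ᵥ h s) / Fintype.card ι := by positivity
  refine ((posDef_one_add_sum_vecMulVec h S).log_det_le hb).trans_eq ?_
  rw [trace_add, trace_one, trace_sum]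
  simp only [trace_vecMulVec]
  have : ((Fintype.card ι : ℝ) + ∑ s ∈ S, h s ⬝ᵥ h s) /
      (1 + (∑ s ∈ S, h s ⬝ᵥ h s) / Fintype.card ι) = Fintype.card ι := by
    rw [div_eq_iff hb.ne']; field_simp
  rw [this]; ring

/-- Jensen's inequality with weights k, through the tangent at the weighted mean b of the arguments.
-/
theorem sum_mul_log_one_add_div_le {r : ℕ} (hr : 0 < r) {lam : ℝ} (hlam : 0 < lam) {S : ℕ → ℝ}
    (hS : ∀ k, 0 ≤ S k) :
    ∑ k ∈ Finset.Icc 1 r, (k : ℝ) * Real.log (1 + S k / lam / k) ≤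
      (1 + (r : ℝ)) * r / 2 *
        Real.log (1 + 2 * (∑ k ∈ Finset.Icc 1 r, S k) / ((1 + (r : ℝ)) * r * lam)) := by
  have hr' : (0 : ℝ) < r := by exact_mod_cast hr
  have hsum : ∑ k ∈ Finset.Icc 1 r, (k : ℝ) = (1 + (r : ℝ)) * r / 2 := by
    clear hr hr'
    induction r with
    | zero => simp
    | succ n ih => rw [Finset.sum_Icc_succ_top (by omega), ih]; push_cast; ring
  have hU : 0 ≤ ∑ k ∈ Finset.Icc 1 r, S k := Finset.sum_nonneg fun k _ => hS k
  set U := ∑ k ∈ Finset.Icc 1 r, S k with hUdef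
  set b := 1 + 2 * U / ((1 + (r : ℝ)) * r * lam) with hb
  have hb0 : 0 < b := by positivity
  calc _ ≤ ∑ k ∈ Finset.Icc 1 r, ((k : ℝ) * (Real.log b - 1) + (k + S k / lam) / b) := by
        refine Finset.sum_le_sum fun k hk => ?_
        have hk0 : (0 : ℝ) < k := by exact_mod_cast (Finset.mem_Icc.1 hk).1
        have := hS k
        have := Real.log_le_log_add_div_sub_one (a := 1 + S k / lam / k) (by positivity) hb0
        refine (mul_le_mul_of_nonneg_left this hk0.le).trans_eq ?_
        field_simp
        ring
    _ = (1 + (r : ℝ)) * r / 2 * (Real.log b - 1)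
          + ((1 + (r : ℝ)) * r / 2 + U / lam) / b := by
        rw [Finset.sum_add_distrib, ← Finset.sum_mul, ← Finset.sum_div, Finset.sum_add_distrib,
          ← Finset.sum_div, hsum]
    _ = _ := by
        have : ((1 + (r : ℝ)) * r / 2 + U / lam) / b = (1 + (r : ℝ)) * r / 2 := by
          rw [div_eq_iff hb0.ne', hb]; field_simp
        rw [this]; ring

/-! ### Kernel, rank and spectrum of Gram matrices -/

theorem inner_toEuclideanLin_gram {d : ℕ} (c : ℕ → ℝ) (g : ℕ → EuclideanSpace ℝ (Fin d)) (n : ℕ)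
    (z y : EuclideanSpace ℝ (Fin d)) :
    inner ℝ z (toEuclideanLin (gram c g n) y) =
      ∑ s ∈ Finset.Icc 1 n, c s * (inner ℝ (g s) z * inner ℝ (g s) y) := by
  rw [EuclideanSpace.inner_eq_star_dotProduct, ofLp_toLpLin, toLin'_apply, gram, sum_mulVec,
    sum_dotProduct]
  refine Finset.sum_congr rfl fun s _ => ?_
  rw [smul_mulVec, vecMulVec_mulVec, EuclideanSpace.inner_eq_star_dotProduct,
    EuclideanSpace.inner_eq_star_dotProduct]
  rw [star_trivial, star_trivial, smul_dotProduct, op_smul_eq_smul, smul_dotProduct,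
    dotProduct_comm (g s).ofLp, dotProduct_comm (g s).ofLp, smul_eq_mul, smul_eq_mul]
  ring

theorem gram_isHermitian {d : ℕ} (c : ℕ → ℝ) (g : ℕ → EuclideanSpace ℝ (Fin d)) (n : ℕ) :
    (gram c g n).IsHermitian := by
  rw [IsHermitian, conjTranspose_eq_transpose_of_trivial, gram, transpose_sum]
  refine Finset.sum_congr rfl fun s _ => ?_
  rw [transpose_smul, transpose_vecMulVec]

theorem inner_eq_zero_of_toEuclideanLin_gram_eq_zero {d : ℕ} {c : ℕ → ℝ}
    {g : ℕ → EuclideanSpace ℝ (Fin d)} {n : ℕ} (hc : ∀ s ∈ Finset.Icc 1 n, 0 < c s)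
    {y : EuclideanSpace ℝ (Fin d)} (hy : toEuclideanLin (gram c g n) y = 0) :
    ∀ s ∈ Finset.Icc 1 n, inner ℝ (g s) y = 0 := by
  have h := inner_toEuclideanLin_gram c g n y y
  rw [hy, inner_zero_right, eq_comm, Finset.sum_eq_zero_iff_of_nonneg
    fun s hs => mul_nonneg (hc s hs).le (mul_self_nonneg _)] at h
  intro s hs
  simpa [(hc s hs).ne'] using h s hs

theorem toEuclideanLin_gram_eq_zero_iff {d : ℕ} {g : ℕ → EuclideanSpace ℝ (Fin d)} {n : ℕ}
    {y : EuclideanSpace ℝ (Fin d)} :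
    toEuclideanLin (gram (fun _ => 1) g n) y = 0 ↔
      ∀ s ∈ Finset.Icc 1 n, inner ℝ (g s) y = 0 := by
  refine ⟨inner_eq_zero_of_toEuclideanLin_gram_eq_zero fun _ _ => one_pos, fun h => ?_⟩
  refine ext_inner_left ℝ fun z => ?_
  rw [inner_toEuclideanLin_gram, inner_zero_right]
  exact Finset.sum_eq_zero fun s hs => by rw [h s hs]; simp

theorem rank_add_finrank_ker_toEuclideanLin {d : ℕ} (A : Matrix (Fin d) (Fin d) ℝ) :
    A.rank + Module.finrank ℝ (LinearMap.ker (toEuclideanLin A)) = d := by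
  have := (toEuclideanLin A).finrank_range_add_finrank_ker
  rw [finrank_euclideanSpace_fin] at this
  refine Eq.trans (congrArg (· + _) ?_) this
  rw [Matrix.rank_eq_finrank_range_toLin A
    (EuclideanSpace.basisFun (Fin d) ℝ).toBasis (EuclideanSpace.basisFun (Fin d) ℝ).toBasis,
    toEuclideanLin_eq_toLin_orthonormal]

theorem ker_gram_antitone {d : ℕ} (g : ℕ → EuclideanSpace ℝ (Fin d)) {m n : ℕ} (h : m ≤ n) :
    LinearMap.ker (toEuclideanLin (gram (fun _ => 1) g n)) ≤
      LinearMap.ker (toEuclideanLin (gram (fun _ => 1) g m)) := by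
  intro y hy
  rw [LinearMap.mem_ker, toEuclideanLin_gram_eq_zero_iff] at hy ⊢
  exact fun s hs => hy s (Finset.Icc_subset_Icc_right h hs)

theorem rank_gram_mono {d : ℕ} (g : ℕ → EuclideanSpace ℝ (Fin d)) {m n : ℕ} (h : m ≤ n) :
    (gram (fun _ => 1) g m).rank ≤ (gram (fun _ => 1) g n).rank := by
  have h1 := rank_add_finrank_ker_toEuclideanLin (gram (fun _ => 1) g m)
  have h2 := rank_add_finrank_ker_toEuclideanLin (gram (fun _ => 1) g n)
  have h3 := Submodule.finrank_mono (ker_gram_antitone g h)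
  omega

/-- Kernels shrink as rounds are added, so equal dimension forces equality: while the rank
stagnates, new gradients lie in the span of the old ones. -/
theorem ker_gram_eq_of_rank_eq {d : ℕ} (g : ℕ → EuclideanSpace ℝ (Fin d)) {m n : ℕ} (h : m ≤ n)
    (hr : (gram (fun _ => 1) g n).rank = (gram (fun _ => 1) g m).rank) :
    LinearMap.ker (toEuclideanLin (gram (fun _ => 1) g n)) =
      LinearMap.ker (toEuclideanLin (gram (fun _ => 1) g m)) := by
  have h1 := rank_add_finrank_ker_toEuclideanLin (gram (fun _ => 1) g m)
  have h2 := rank_add_finrank_ker_toEuclideanLin (gram (fun _ => 1) g n)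
  exact Submodule.eq_of_le_of_finrank_eq (ker_gram_antitone g h) (by omega)

theorem eq_zero_of_rank_gram_eq_zero {d : ℕ} {g : ℕ → EuclideanSpace ℝ (Fin d)} {n t : ℕ}
    (ht : t ∈ Finset.Icc 1 n) (hr : (gram (fun _ => 1) g n).rank = 0) : g t = 0 := by
  have h1 := rank_add_finrank_ker_toEuclideanLin (gram (fun _ => 1) g n)
  have h2 : LinearMap.ker (toEuclideanLin (gram (fun _ => 1) g n)) = ⊤ :=
    Submodule.eq_top_of_finrank_eq (by rw [finrank_euclideanSpace_fin]; omega)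
  have h3 : g t ∈ LinearMap.ker (toEuclideanLin (gram (fun _ => 1) g n)) := h2 ▸ trivial
  rw [LinearMap.mem_ker, toEuclideanLin_gram_eq_zero_iff] at h3
  exact inner_self_eq_zero.1 (h3 t ht)

theorem eigenvalue_gram_nonneg {d : ℕ} {g : ℕ → EuclideanSpace ℝ (Fin d)} {n : ℕ} {μ : ℝ}
    (h : Module.End.HasEigenvalue (toEuclideanLin (gram (fun _ => 1) g n)) μ) : 0 ≤ μ := by
  obtain ⟨v, hv⟩ := h.exists_hasEigenvector
  have h1 := inner_toEuclideanLin_gram (fun _ => 1) g n v v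
  rw [hv.apply_eq_smul, real_inner_smul_right] at h1
  have h2 : 0 < inner ℝ v v := real_inner_self_pos.2 hv.2
  refine nonneg_of_mul_nonneg_left ?_ h2
  rw [h1]
  exact Finset.sum_nonneg fun s _ => by rw [one_mul]; exact mul_self_nonneg _

theorem toEuclideanLin_eigenvectorBasis {d : ℕ} {A : Matrix (Fin d) (Fin d) ℝ}
    (hA : A.IsHermitian) (i : Fin d) :
    toEuclideanLin A (hA.eigenvectorBasis i) = hA.eigenvalues i • hA.eigenvectorBasis i := by
  rw [toLpLin_apply, hA.mulVec_eigenvectorBasis]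
  rfl

theorem hasEigenvalue_toEuclideanLin_eigenvalues {d : ℕ} {A : Matrix (Fin d) (Fin d) ℝ}
    (hA : A.IsHermitian) (i : Fin d) :
    Module.End.HasEigenvalue (toEuclideanLin A) (hA.eigenvalues i) :=
  Module.End.hasEigenvalue_of_hasEigenvector
    ⟨Module.End.mem_eigenspace_iff.2 (toEuclideanLin_eigenvectorBasis hA i),
      by simpa using hA.eigenvectorBasis.toBasis.ne_zero i⟩

theorem lambdaStar_le {d : ℕ} {T : ℕ} {g : ℕ → EuclideanSpace ℝ (Fin d)} {t : ℕ}
    (ht : t ∈ Finset.Icc 1 T) {μ : ℝ} (hμ : μ ≠ 0)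
    (h : Module.End.HasEigenvalue (toEuclideanLin (gram (fun _ => 1) g t)) μ) :
    lambdaStar T g ≤ μ :=
  csInf_le ⟨0, by rintro _ ⟨_, _, _, h⟩; exact eigenvalue_gram_nonneg h⟩ ⟨hμ, t, ht, h⟩

/-- Only finitely many eigenvalues occur, so the infimum is attained; positive rank supplies at
least one nonzero eigenvalue. -/
theorem lambdaStar_pos {d : ℕ} {T : ℕ} {g : ℕ → EuclideanSpace ℝ (Fin d)}
    (hr : 0 < finalRank T g) : 0 < lambdaStar T g := by
  have hne : {μ : ℝ | μ ≠ 0 ∧ ∃ t ∈ Finset.Icc 1 T,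
      Module.End.HasEigenvalue (toEuclideanLin (gram (fun _ => 1) g t)) μ}.Nonempty := by
    have hA := gram_isHermitian (fun _ => 1) g T
    have hT : 1 ≤ T := by
      by_contra h
      have : T = 0 := by omega
      subst this
      simp [finalRank, gram] at hr
    rw [finalRank, hA.rank_eq_card_non_zero_eigs, Fintype.card_pos_iff] at hr
    obtain ⟨i, hi⟩ := hr
    exact ⟨_, hi, T, Finset.mem_Icc.2 ⟨hT, le_rfl⟩, hasEigenvalue_toEuclideanLin_eigenvalues hA i⟩
  have hfin : {μ : ℝ | μ ≠ 0 ∧ ∃ t ∈ Finset.Icc 1 T,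
      Module.End.HasEigenvalue (toEuclideanLin (gram (fun _ => 1) g t)) μ}.Finite := by
    refine ((Finset.Icc 1 T).finite_toSet.biUnion fun t _ =>
      Module.End.finite_hasEigenvalue (toEuclideanLin (gram (fun _ => 1) g t))).subset ?_
    rintro μ ⟨_, t, ht, h⟩
    exact Set.mem_biUnion ht h
  obtain ⟨h0, t, _, h⟩ := hne.csInf_mem hfin
  exact (eigenvalue_gram_nonneg h).lt_of_ne' h0

/-! ### Leverage sums grouped by rank -/

theorem sum_subtype_ne_zero_eq {ι : Type*} [Fintype ι] {D f : ι → ℝ}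
    (h : ∀ i, D i = 0 → f i = 0) : ∑ i : {i // D i ≠ 0}, f i = ∑ i, f i := by
  classical
  rw [← Fintype.sum_subtype_add_sum_subtype (fun i => D i ≠ 0) f, left_eq_add]
  exact Finset.sum_eq_zero fun i _ => h i (not_not.1 i.2)

/-- The total leverage of a set of rounds during which the rank of the Gram matrix does not
change. -/
theorem sum_leverage_le_of_rank_eq {d : ℕ} {T : ℕ} {g : ℕ → EuclideanSpace ℝ (Fin d)} {m : ℕ}
    (hm : m ∈ Finset.Icc 1 T) (hk : 0 < (gram (fun _ => 1) g m).rank)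
    (hlam : 0 < lambdaStar T g) {S : Finset ℕ} (hS : ∀ t ∈ S, m < t)
    (hrank : ∀ t ∈ S, (gram (fun _ => 1) g t).rank = (gram (fun _ => 1) g m).rank)
    (y : ℕ → EuclideanSpace ℝ (Fin d)) :
    ∑ t ∈ S, (2 * inner ℝ (g t) (y t) - ∑ s ∈ Finset.Icc 1 t, (inner ℝ (g s) (y t)) ^ 2) ≤
      ((gram (fun _ => 1) g m).rank : ℝ) * Real.log (1 + (∑ s ∈ S, ‖g s‖ ^ 2) / lambdaStar T g /
        ((gram (fun _ => 1) g m).rank : ℝ)) := by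
  have hA := gram_isHermitian (fun _ => 1) g m
  set e := hA.eigenvectorBasis
  set D := hA.eigenvalues
  have hDlam : ∀ i, D i ≠ 0 → lambdaStar T g ≤ D i := fun i hi =>
    lambdaStar_le hm hi (hasEigenvalue_toEuclideanLin_eigenvalues hA i)
  have hD : ∀ i, 0 ≤ D i := fun i =>
    eigenvalue_gram_nonneg (hasEigenvalue_toEuclideanLin_eigenvalues hA i)
  have horth : ∀ t ∈ S, ∀ i, D i = 0 → inner ℝ (g t) (e i) = 0 := by
    intro t ht i hi
    have h1 : e i ∈ LinearMap.ker (toEuclideanLin (gram (fun _ => 1) g t)) := by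
      rw [ker_gram_eq_of_rank_eq g (hS t ht).le (hrank t ht), LinearMap.mem_ker,
        toEuclideanLin_eigenvectorBasis hA i]
      exact smul_eq_zero_of_left hi _
    rw [LinearMap.mem_ker, toEuclideanLin_gram_eq_zero_iff] at h1
    exact h1 t (Finset.mem_Icc.2 ⟨by have := hS t ht; omega, le_rfl⟩)
  -- Coordinates on the range of the Gram matrix at m in which it becomes the identity: h ⬝ᵥ z is
  -- ⟨g, y⟩, and z ⬝ᵥ z is its quadratic form at y. Dividing by √D costs at most the factor 1/λ* in
  -- ‖g‖².
  let h : ℕ → {i // D i ≠ 0} → ℝ := fun t i => inner ℝ (g t) (e i) / √(D i)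
  let z : ℕ → {i // D i ≠ 0} → ℝ := fun t i => √(D i) * inner ℝ (e i) (y t)
  have hsqrt : ∀ i : {i // D i ≠ 0}, √(D i) ≠ 0 := fun i =>
    (Real.sqrt_pos.2 ((hD i).lt_of_ne' i.2)).ne'
  have hhz : ∀ s ∈ S, ∀ t, h s ⬝ᵥ z t = inner ℝ (g s) (y t) := by
    intro s hs t
    rw [← e.sum_inner_mul_inner, ← sum_subtype_ne_zero_eq (D := D)
      (fun i hi => by rw [horth s hs i hi, zero_mul])]
    refine Finset.sum_congr rfl fun i _ => ?_
    have := hsqrt i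
    simp only [h, z]
    field_simp
  have hzz : ∀ t, z t ⬝ᵥ z t = ∑ s ∈ Finset.Icc 1 m, (inner ℝ (g s) (y t)) ^ 2 := by
    intro t
    have h1 := inner_toEuclideanLin_gram (fun _ => 1) g m (y t) (y t)
    simp only [one_mul, ← sq] at h1
    rw [← h1, ← e.sum_inner_mul_inner]
    have h2 : ∀ i, inner ℝ (e i) (toEuclideanLin (gram (fun _ => 1) g m) (y t)) =
        D i * inner ℝ (e i) (y t) := by
      intro i
      rw [← (isSymmetric_toEuclideanLin_iff.2 hA) (e i) (y t), toEuclideanLin_eigenvectorBasis hA i,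
        real_inner_smul_left]
    rw [← sum_subtype_ne_zero_eq (D := D) (fun i hi => by rw [h2, hi]; ring)]
    refine Finset.sum_congr rfl fun i _ => ?_
    rw [h2, real_inner_comm (e i) (y t)]
    have := Real.mul_self_sqrt (hD i)
    simp only [z]
    linear_combination (inner ℝ (e i) (y t)) ^ 2 * this
  have hhh : ∀ s ∈ S, h s ⬝ᵥ h s ≤ ‖g s‖ ^ 2 / lambdaStar T g := by
    intro s hs
    rw [← real_inner_self_eq_norm_sq, ← e.sum_inner_mul_inner, Finset.sum_div,
      ← sum_subtype_ne_zero_eq (D := D) (fun i hi => by rw [horth s hs i hi, zero_mul, zero_div])]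
    refine Finset.sum_le_sum fun i _ => ?_
    have h1 : h s i * h s i = inner ℝ (g s) (e i) ^ 2 / D i := by
      simp only [h]
      rw [div_mul_div_comm, Real.mul_self_sqrt (hD i), sq]
    rw [h1, real_inner_comm (g s) (e i), ← sq]
    exact div_le_div_of_nonneg_left (sq_nonneg _) hlam (hDlam i i.2)
  have hcard := hA.rank_eq_card_non_zero_eigs
  have hne : Nonempty {i // D i ≠ 0} := by
    rw [hcard] at hk; exact Fintype.card_pos_iff.1 hk
  have hk' : (0 : ℝ) < ((gram (fun _ => 1) g m).rank : ℝ) := by exact_mod_cast hk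
  have hhnn : 0 ≤ ∑ s ∈ S, h s ⬝ᵥ h s :=
    Finset.sum_nonneg fun s _ => Finset.sum_nonneg fun i _ => mul_self_nonneg _
  have hmain := sum_leverage_le h z S
  rw [← hcard] at hmain
  refine (Finset.sum_le_sum fun t ht => ?_).trans (hmain.trans ?_)
  · have hfilter : ∑ s ∈ S with s ≤ t, (h s ⬝ᵥ z t) ^ 2 =
        ∑ s ∈ S with s ≤ t, inner ℝ (g s) (y t) ^ 2 :=
      Finset.sum_congr rfl fun s hs => by rw [hhz s (Finset.mem_of_mem_filter s hs) t]
    rw [hhz t ht, hzz, hfilter, sub_sub]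
    refine sub_le_sub_left ?_ _
    -- Rounds up to m and rounds of S up to t are disjoint parts of 1, …, t; the remaining squares
    -- only help.
    have hdisj : Disjoint (Finset.Icc 1 m) {s ∈ S | s ≤ t} := by
      refine Finset.disjoint_left.2 fun s hs hs' => ?_
      have := hS s (Finset.mem_of_mem_filter s hs')
      have := (Finset.mem_Icc.1 hs).2
      omega
    rw [← Finset.sum_union hdisj]
    refine Finset.sum_le_sum_of_subset_of_nonneg ?_ fun _ _ _ => sq_nonneg _
    intro s hs
    have := hS t ht
    rcases Finset.mem_union.1 hs with hs | hs
    · have := Finset.mem_Icc.1 hs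
      exact Finset.mem_Icc.2 (by omega)
    · obtain ⟨hs, hst⟩ := Finset.mem_filter.1 hs
      have := hS s hs
      exact Finset.mem_Icc.2 (by omega)
  · gcongr
    rw [Finset.sum_div]
    exact Finset.sum_le_sum hhh

theorem sum_leverage_le_logTerm {d : ℕ} (T : ℕ) (g y : ℕ → EuclideanSpace ℝ (Fin d)) :
    ∑ t ∈ Finset.Icc 1 T,
      (2 * inner ℝ (g t) (y t) - ∑ s ∈ Finset.Icc 1 t, (inner ℝ (g s) (y t)) ^ 2) ≤
      logTerm T g := by
  set f : ℕ → ℝ := fun t =>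
    2 * inner ℝ (g t) (y t) - ∑ s ∈ Finset.Icc 1 t, (inner ℝ (g s) (y t)) ^ 2 with hf
  set ρ : ℕ → ℕ := fun t => (gram (fun _ => 1) g t).rank with hρ
  set r := finalRank T g with hr
  set F : ℕ → Finset ℕ := fun k => {t ∈ Finset.Icc 1 T | ρ t = k} with hF
  have hmaps : ∀ t ∈ Finset.Icc 1 T, ρ t ∈ insert 0 (Finset.Icc 1 r) := by
    intro t ht
    have : ρ t ≤ r := rank_gram_mono g (Finset.mem_Icc.1 ht).2
    simp only [Finset.mem_insert, Finset.mem_Icc]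
    omega
  have hsplit : ∀ φ : ℕ → ℝ, ∑ t ∈ Finset.Icc 1 T, φ t =
      ∑ t ∈ F 0, φ t + ∑ k ∈ Finset.Icc 1 r, ∑ t ∈ F k, φ t := by
    intro φ
    rw [← Finset.sum_fiberwise_of_maps_to hmaps, Finset.sum_insert (by simp)]
  have hg0 : ∀ t ∈ F 0, g t = 0 := by
    intro t ht
    obtain ⟨ht, h0⟩ := Finset.mem_filter.1 ht
    exact eq_zero_of_rank_gram_eq_zero
      (Finset.mem_Icc.2 ⟨(Finset.mem_Icc.1 ht).1, le_rfl⟩) h0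
  have hzero : ∑ t ∈ F 0, f t ≤ 0 := by
    refine Finset.sum_nonpos fun t ht => ?_
    simp only [hf, hg0 t ht, inner_zero_left, mul_zero, zero_sub, neg_nonpos]
    exact Finset.sum_nonneg fun _ _ => sq_nonneg _
  rw [hsplit]
  rcases Nat.eq_zero_or_pos r with hr0 | hr0
  · rw [logTerm, ← hr, hr0]
    simpa only [Finset.Icc_eq_empty_of_lt one_pos, Finset.sum_empty, add_zero, Nat.cast_zero,
      mul_zero, zero_div, zero_mul] using hzero
  have hlam : 0 < lambdaStar T g := lambdaStar_pos hr0
  set Q : ℕ → ℝ := fun k => ∑ t ∈ F k, ‖g t‖ ^ 2 with hQ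
  have hQ0 : ∀ k, 0 ≤ Q k := fun k => Finset.sum_nonneg fun _ _ => sq_nonneg _
  have hblock : ∀ k ∈ Finset.Icc 1 r,
      ∑ t ∈ F k, f t ≤ 1 + (k : ℝ) * Real.log (1 + Q k / lambdaStar T g / k) := by
    intro k hk
    have hk1 := (Finset.mem_Icc.1 hk).1
    have hk0 : (0 : ℝ) < k := by exact_mod_cast hk1
    have hQk := hQ0 k
    -- Allowing empty groups makes it unnecessary to know that the rank grows by at most one per
    -- round.
    rcases (F k).eq_empty_or_nonempty with hE | hE
    · rw [hE, Finset.sum_empty]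
      have : 0 ≤ Real.log (1 + Q k / lambdaStar T g / k) :=
        Real.log_nonneg (le_add_of_nonneg_right (by positivity))
      positivity
    set m := (F k).min' hE with hm
    have hmF : m ∈ F k := (F k).min'_mem hE
    obtain ⟨hmT, hmk⟩ := Finset.mem_filter.1 hmF
    rw [← Finset.add_sum_erase _ _ hmF]
    refine add_le_add ?_ ?_
    -- The first round of the group is bounded by 2a - a² ≤ 1, the source of the summand r; it then
    -- anchors the other rounds.
    · have : (inner ℝ (g m) (y m)) ^ 2 ≤ ∑ s ∈ Finset.Icc 1 m, (inner ℝ (g s) (y m)) ^ 2 :=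
        Finset.single_le_sum (f := fun s => (inner ℝ (g s) (y m)) ^ 2) (fun _ _ => sq_nonneg _)
          (Finset.mem_Icc.2 ⟨(Finset.mem_Icc.1 hmT).1, le_rfl⟩)
      simp only [hf]
      nlinarith [sq_nonneg (inner ℝ (g m) (y m) - 1)]
    · have := sum_leverage_le_of_rank_eq hmT (by change 0 < ρ m; omega) hlam
        (S := (F k).erase m) (fun t ht => ?_) (fun t ht => ?_) y
      · change _ ≤ ((ρ m : ℕ) : ℝ) * Real.log (1 + _ / _ / ((ρ m : ℕ) : ℝ)) at this
        rw [hmk] at this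
        refine this.trans ?_
        have h1 : 0 ≤ ∑ s ∈ (F k).erase m, ‖g s‖ ^ 2 := Finset.sum_nonneg fun _ _ => sq_nonneg _
        have h2 : ∑ s ∈ (F k).erase m, ‖g s‖ ^ 2 ≤ Q k :=
          Finset.sum_le_sum_of_subset_of_nonneg (Finset.erase_subset _ _) fun _ _ _ => sq_nonneg _
        gcongr
      · obtain ⟨hne, ht⟩ := Finset.mem_erase.1 ht
        exact ((F k).min'_le t ht).lt_of_ne' hne
      · exact (Finset.mem_filter.1 (Finset.mem_of_mem_erase ht)).2.trans hmk.symm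
  have hQsum : ∑ k ∈ Finset.Icc 1 r, Q k = ∑ t ∈ Finset.Icc 1 T, ‖g t‖ ^ 2 := by
    rw [hsplit, Finset.sum_eq_zero (s := F 0) fun t ht => by simp [hg0 t ht], zero_add]
  have hjensen := sum_mul_log_one_add_div_le hr0 hlam hQ0
  rw [hQsum] at hjensen
  have hsum := Finset.sum_le_sum hblock
  rw [Finset.sum_add_distrib] at hsum
  simp only [Finset.sum_const, Nat.card_Icc, add_tsub_cancel_right, nsmul_eq_mul, mul_one] at hsum
  rw [logTerm, ← hr]
  linarith

/-! ### Pseudoinverse step and projection in a seminorm -/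

/-- With positive weights g_t is orthogonal to the kernel, hence by symmetry in the range, where A
A^† is the identity. -/
theorem toEuclideanLin_pinv_gram {d : ℕ} {c : ℕ → ℝ} {g : ℕ → EuclideanSpace ℝ (Fin d)} {n : ℕ}
    (hc : ∀ s ∈ Finset.Icc 1 n, 0 < c s) {t : ℕ} (ht : t ∈ Finset.Icc 1 n) :
    toEuclideanLin (gram c g n) (toEuclideanLin (pinv (gram c g n)) (g t)) = g t := by
  have hsymm := isSymmetric_toEuclideanLin_iff.2 (gram_isHermitian c g n)
  have hmem : g t ∈ LinearMap.range (toEuclideanLin (gram c g n)) := by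
    rw [← (LinearMap.range (toEuclideanLin (gram c g n))).orthogonal_orthogonal,
      hsymm.orthogonal_range, Submodule.mem_orthogonal']
    intro y hy
    exact inner_eq_zero_of_toEuclideanLin_gram_eq_zero hc hy t ht
  obtain ⟨y, hy⟩ := hmem
  rw [← hy]
  simp only [toLpLin_apply, mulVec_mulVec]
  rw [← Matrix.mul_assoc, (pinv_spec _).mul_mul_self]

/-- The projection inequality in the seminorm of a weighted Gram matrix. -/
theorem sum_sq_le_of_isMinOn_matNorm {d : ℕ} {c : ℕ → ℝ} {g : ℕ → EuclideanSpace ℝ (Fin d)}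
    {n : ℕ} (hc : ∀ s ∈ Finset.Icc 1 n, 0 ≤ c s) {K : Set (EuclideanSpace ℝ (Fin d))}
    (hK : Convex ℝ K) {u p v : EuclideanSpace ℝ (Fin d)} (hp : p ∈ K) (hv : v ∈ K)
    (hmin : IsMinOn (fun v => matNorm (gram c g n) (v - u)) K p) :
    ∑ s ∈ Finset.Icc 1 n, c s * inner ℝ (g s) (p - v) ^ 2 ≤
      ∑ s ∈ Finset.Icc 1 n, c s * inner ℝ (g s) (u - v) ^ 2 := by
  have hq : ∀ z, inner ℝ z (toEuclideanLin (gram c g n) z) =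
      ∑ s ∈ Finset.Icc 1 n, c s * inner ℝ (g s) z ^ 2 := fun z => by
    simp only [inner_toEuclideanLin_gram, sq]
  have hq0 : ∀ z, 0 ≤ ∑ s ∈ Finset.Icc 1 n, c s * inner ℝ (g s) z ^ 2 := fun z =>
    Finset.sum_nonneg fun s hs => mul_nonneg (hc s hs) (sq_nonneg _)
  set α := ∑ s ∈ Finset.Icc 1 n, c s * inner ℝ (g s) (v - p) ^ 2 with hα
  set β := ∑ s ∈ Finset.Icc 1 n, c s * (inner ℝ (g s) (p - u) * inner ℝ (g s) (v - p)) with hβ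
  have hline : ∀ τ : ℝ, 0 ≤ τ → τ ≤ 1 → 0 ≤ τ * (2 * β + τ * α) := by
    intro τ h0 h1
    have hm : p + τ • (v - p) ∈ K := hK.add_smul_sub_mem hp hv ⟨h0, h1⟩
    have h2 := hmin hm
    simp only [Set.mem_ofPred_eq, matNorm, hq] at h2
    rw [Real.sqrt_le_sqrt_iff (hq0 _)] at h2
    have h3 : ∑ s ∈ Finset.Icc 1 n, c s * inner ℝ (g s) (p + τ • (v - p) - u) ^ 2 =
        ∑ s ∈ Finset.Icc 1 n, c s * inner ℝ (g s) (p - u) ^ 2 + τ * (2 * β + τ * α) := by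
      rw [hα, hβ, Finset.mul_sum, Finset.mul_sum, ← Finset.sum_add_distrib, Finset.mul_sum,
        ← Finset.sum_add_distrib]
      refine Finset.sum_congr rfl fun s _ => ?_
      rw [show p + τ • (v - p) - u = (p - u) + τ • (v - p) by abel, inner_add_right,
        real_inner_smul_right]
      ring
    linarith
  have hα0 : 0 ≤ α := hq0 _
  have hβ0 : 0 ≤ β := by
    by_contra hneg
    push Not at hneg
    have hpos : 0 < α - β := by linarith
    -- This τ lies in (0, 1] even when α = 0, and τ α ≤ -β turns 2β + τ α into at most β < 0.
    have hτ0 : 0 < -β / (α - β) := div_pos (by linarith) hpos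
    have hτ1 : -β / (α - β) ≤ 1 := by rw [div_le_one hpos]; linarith
    have h4 := nonneg_of_mul_nonneg_right (hline _ hτ0.le hτ1) hτ0
    have h5 : -β / (α - β) * α ≤ -β := by
      rw [div_mul_eq_mul_div, div_le_iff₀ hpos]
      nlinarith
    linarith
  have h6 : ∑ s ∈ Finset.Icc 1 n, c s * inner ℝ (g s) (u - v) ^ 2 =
      ∑ s ∈ Finset.Icc 1 n, c s * inner ℝ (g s) (p - v) ^ 2 +
        (2 * β + ∑ s ∈ Finset.Icc 1 n, c s * inner ℝ (g s) (p - u) ^ 2) := by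
    rw [hβ, Finset.mul_sum, ← Finset.sum_add_distrib, ← Finset.sum_add_distrib]
    refine Finset.sum_congr rfl fun s _ => ?_
    simp only [inner_sub_right]
    ring
  have := hq0 (p - u)
  linarith

/-! ### Slabs, gradients and the regret bound -/

theorem convex_slab {d : ℕ} (C : ℝ) (x : ℕ → EuclideanSpace ℝ (Fin d)) (t : ℕ) :
    Convex ℝ (slab C x t) := by
  intro u hu v hv a b ha hb hab
  simp only [slab, Set.mem_ofPred_eq, inner_add_left, real_inner_smul_left] at *
  rw [abs_le] at *
  constructor <;> nlinarith

theorem mem_slab_of_mem_comparators {d : ℕ} {C : ℝ} {x : ℕ → EuclideanSpace ℝ (Fin d)} {T t : ℕ}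
    {v : EuclideanSpace ℝ (Fin d)} (hv : v ∈ comparators C x T) (ht : t ∈ Finset.Icc 1 T) :
    v ∈ slab C x t :=
  Set.mem_iInter₂.1 hv t ht

theorem gradient_roundLoss {d : ℕ} {x : ℕ → EuclideanSpace ℝ (Fin d)} {ℓ : ℕ → ℝ → ℝ} {t : ℕ}
    (h : Differentiable ℝ (ℓ t)) (w : EuclideanSpace ℝ (Fin d)) :
    gradient (roundLoss x ℓ t) w = deriv (ℓ t) (inner ℝ w (x t)) • x t := by
  refine HasGradientAt.gradient ?_
  rw [hasGradientAt_iff_hasFDerivAt]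
  have h1 : HasFDerivAt (fun w : EuclideanSpace ℝ (Fin d) => inner ℝ w (x t))
      (innerSL ℝ (x t)) w := by
    have := (innerSL ℝ (x t)).hasFDerivAt (x := w)
    refine this.congr_of_eventuallyEq (Filter.Eventually.of_forall fun z => ?_)
    simp [real_inner_comm]
  have h2 := (h (inner ℝ w (x t))).hasDerivAt.comp_hasFDerivAt w h1
  refine h2.congr_fderiv ?_
  ext z
  simp

/-- The gradient is a multiple of x_t, so only predictions matter: slope at most L, difference of
predictions at most 2 C. -/
theorem abs_inner_iterGrad_le {d : ℕ} {T : ℕ} {C L : ℝ} {x : ℕ → EuclideanSpace ℝ (Fin d)}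
    {ℓ : ℕ → ℝ → ℝ} {σ : ℕ → ℝ} (hloss : LossAssumptions C L T x ℓ σ)
    {w : ℕ → EuclideanSpace ℝ (Fin d)} {v : EuclideanSpace ℝ (Fin d)} {t : ℕ}
    (ht : t ∈ Finset.Icc 1 T) (hw : w t ∈ slab C x t) (hv : v ∈ slab C x t) :
    |inner ℝ (iterGrad x ℓ w t) (w t - v)| ≤ 2 * C * L := by
  rw [iterGrad, gradient_roundLoss (hloss.differentiable t ht), real_inner_smul_left, abs_mul]
  have h1 := hloss.lipschitz t ht _ hw
  have h2 : |inner ℝ (x t) (w t - v)| ≤ C + C := by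
    rw [inner_sub_right, real_inner_comm (w t), real_inner_comm v]
    exact (abs_sub _ _).trans (add_le_add hw hv)
  calc _ ≤ L * (C + C) := mul_le_mul h1 h2 (abs_nonneg _) ((abs_nonneg _).trans h1)
    _ = 2 * C * L := by ring

theorem OnlineNewton.IsInvariantRun.mem_slab {d : ℕ} {C : ℝ} {T : ℕ} {x : ℕ → EuclideanSpace ℝ (Fin d)}
    {ℓ : ℕ → ℝ → ℝ} {σ η : ℕ → ℝ} {w : ℕ → EuclideanSpace ℝ (Fin d)}
    (h : IsInvariantRun C T x ℓ σ η w) {t : ℕ} (ht : t ∈ Finset.Icc 1 T) :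
    w t ∈ slab C x t := by
  obtain ⟨h1, h2⟩ := Finset.mem_Icc.1 ht
  rcases Nat.lt_or_ge 1 t with h3 | h3
  · have := h.mem (t - 1) (by omega) (by omega)
    rwa [Nat.sub_add_cancel h1] at this
  · obtain rfl : t = 1 := by omega
    exact h.init h2

theorem two_mul_sum_inner_le {d : ℕ} {C : ℝ} {T : ℕ} {x : ℕ → EuclideanSpace ℝ (Fin d)}
    {ℓ : ℕ → ℝ → ℝ} {σ η : ℕ → ℝ} {w : ℕ → EuclideanSpace ℝ (Fin d)}
    (hrun : IsInvariantRun C T x ℓ σ η w) (hc : ∀ t ∈ Finset.Icc 1 T, 0 < σ t + η t)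
    {v : EuclideanSpace ℝ (Fin d)} (hv : v ∈ comparators C x T) {g p : ℕ → EuclideanSpace ℝ (Fin d)}
    (hg : g = iterGrad x ℓ w)
    (hp : ∀ t, p t = toEuclideanLin (pinv (gram (fun s => σ s + η s) g t)) (g t)) :
    2 * ∑ t ∈ Finset.Icc 1 T, inner ℝ (g t) (w t - v) ≤
      ∑ t ∈ Finset.Icc 1 T,
        ((σ t + η t) * inner ℝ (g t) (w t - v) ^ 2 + inner ℝ (g t) (p t)) := by
  set c : ℕ → ℝ := fun s => σ s + η s with hcdef
  have hsub : ∀ {n}, n ≤ T → ∀ s ∈ Finset.Icc 1 n, 0 < c s := fun hn s hs =>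
    hc s (Finset.Icc_subset_Icc_right hn hs)
  -- The potential is the squared A_n-distance from the unprojected point w_n - p_n to v.
  have key : ∀ n ≤ T, 2 * ∑ t ∈ Finset.Icc 1 n, inner ℝ (g t) (w t - v) +
      ∑ s ∈ Finset.Icc 1 n, c s * inner ℝ (g s) (w n - p n - v) ^ 2 ≤
      ∑ t ∈ Finset.Icc 1 n, (c t * inner ℝ (g t) (w t - v) ^ 2 + inner ℝ (g t) (p t)) := by
    intro n
    induction n with
    | zero => simp
    | succ n ih =>
      intro hn
      have ih := ih (by omega)
      have hproj : ∑ s ∈ Finset.Icc 1 n, c s * inner ℝ (g s) (w (n + 1) - v) ^ 2 ≤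
          ∑ s ∈ Finset.Icc 1 n, c s * inner ℝ (g s) (w n - p n - v) ^ 2 := by
        -- For n = 0 both sums are empty: no projection produces w_1, and no initial distance enters
        -- the bound.
        rcases Nat.eq_zero_or_pos n with rfl | h1
        · simp
        · have hmin := hrun.argmin n h1 (by omega)
          rw [← hg, ← hp] at hmin
          exact sum_sq_le_of_isMinOn_matNorm (fun s hs => (hsub (by omega) s hs).le)
            (convex_slab C x (n + 1)) (hrun.mem n h1 (by omega))
            (mem_slab_of_mem_comparators hv (Finset.mem_Icc.2 ⟨by omega, hn⟩)) hmin
      -- A_{n+1} p_{n+1} = g_{n+1}, paired with z; it evaluates both the cross term and the square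
      -- of the step.
      have hAp : ∀ z, ∑ s ∈ Finset.Icc 1 (n + 1),
          c s * (inner ℝ (g s) z * inner ℝ (g s) (p (n + 1))) = inner ℝ (g (n + 1)) z := by
        intro z
        rw [← inner_toEuclideanLin_gram, hp,
          toEuclideanLin_pinv_gram (hsub hn) (Finset.mem_Icc.2 ⟨by omega, le_rfl⟩),
          real_inner_comm]
      have hexp : ∑ s ∈ Finset.Icc 1 (n + 1),
            c s * inner ℝ (g s) (w (n + 1) - p (n + 1) - v) ^ 2 =
          ∑ s ∈ Finset.Icc 1 (n + 1), c s * inner ℝ (g s) (w (n + 1) - v) ^ 2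
            - 2 * inner ℝ (g (n + 1)) (w (n + 1) - v) + inner ℝ (g (n + 1)) (p (n + 1)) := by
        rw [← hAp (w (n + 1) - v), ← hAp (p (n + 1)), Finset.mul_sum, ← Finset.sum_sub_distrib,
          ← Finset.sum_add_distrib]
        refine Finset.sum_congr rfl fun s _ => ?_
        rw [sub_right_comm, inner_sub_right (g s) (w (n + 1) - v)]
        ring
      rw [hexp, Finset.sum_Icc_succ_top (by omega), Finset.sum_Icc_succ_top (by omega),
        Finset.sum_Icc_succ_top (by omega)]
      linarith
  have h1 := key T le_rfl
  have h2 : 0 ≤ ∑ s ∈ Finset.Icc 1 T, c s * inner ℝ (g s) (w T - p T - v) ^ 2 :=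
    Finset.sum_nonneg fun s hs => mul_nonneg (hc s hs).le (sq_nonneg _)
  linarith

/-- Test vector y = κ p_t: since ∑ c_s ⟨g_s, p_t⟩² = ⟨g_t, p_t⟩ and κ ≤ c_s, the quadratic term
takes back at most half of 2 κ ⟨g_t, p_t⟩. -/
theorem sum_inner_pinv_le_logTerm {d : ℕ} {T : ℕ} {c : ℕ → ℝ} {κ : ℝ} (hκ : 0 < κ)
    (hc : ∀ t ∈ Finset.Icc 1 T, κ ≤ c t) {g p : ℕ → EuclideanSpace ℝ (Fin d)}
    (hp : ∀ t, p t = toEuclideanLin (pinv (gram c g t)) (g t)) :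
    κ * ∑ t ∈ Finset.Icc 1 T, inner ℝ (g t) (p t) ≤ logTerm T g := by
  refine le_trans ?_ (sum_leverage_le_logTerm T g fun t => κ • p t)
  rw [Finset.mul_sum]
  refine Finset.sum_le_sum fun t ht => ?_
  have hsub : ∀ s ∈ Finset.Icc 1 t, κ ≤ c s := fun s hs =>
    hc s (Finset.Icc_subset_Icc_right (Finset.mem_Icc.1 ht).2 hs)
  have h1 : ∑ s ∈ Finset.Icc 1 t, c s * inner ℝ (g s) (p t) ^ 2 = inner ℝ (g t) (p t) := by
    simp only [sq]
    rw [← inner_toEuclideanLin_gram, hp,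
      toEuclideanLin_pinv_gram (fun s hs => hκ.trans_le (hsub s hs))
        (Finset.mem_Icc.2 ⟨(Finset.mem_Icc.1 ht).1, le_rfl⟩), real_inner_comm]
  have h2 : ∑ s ∈ Finset.Icc 1 t, inner ℝ (g s) (κ • p t) ^ 2 ≤ κ * inner ℝ (g t) (p t) := by
    rw [← h1, Finset.mul_sum]
    refine Finset.sum_le_sum fun s hs => ?_
    rw [real_inner_smul_right, mul_pow, sq, mul_assoc]
    exact mul_le_mul_of_nonneg_left
      (mul_le_mul_of_nonneg_right (hsub s hs) (sq_nonneg _)) hκ.le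
  rw [real_inner_smul_right]
  linarith

theorem regretTo_le {d : ℕ} {T : ℕ} {C L : ℝ} {x : ℕ → EuclideanSpace ℝ (Fin d)}
    {ℓ : ℕ → ℝ → ℝ} {σ η : ℕ → ℝ} (hloss : LossAssumptions C L T x ℓ σ)
    (hη : ∀ t ∈ Finset.Icc 1 T, 0 ≤ η t) {κ : ℝ} (hκ : 0 < κ)
    (hc : ∀ t ∈ Finset.Icc 1 T, κ ≤ σ t + η t) {w : ℕ → EuclideanSpace ℝ (Fin d)}
    (hrun : IsInvariantRun C T x ℓ σ η w) {v : EuclideanSpace ℝ (Fin d)}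
    (hv : v ∈ comparators C x T) :
    regretTo x ℓ T w v ≤
      1 / (2 * κ) * logTerm T (iterGrad x ℓ w) + 2 * (C * L) ^ 2 * ∑ t ∈ Finset.Icc 1 T, η t := by
  have h1 := two_mul_sum_inner_le hrun (fun t ht => hκ.trans_le (hc t ht)) hv rfl fun _ => rfl
  have h2 := sum_inner_pinv_le_logTerm (g := iterGrad x ℓ w) hκ hc fun _ => rfl
  rw [Finset.sum_add_distrib] at h1
  set P := ∑ t ∈ Finset.Icc 1 T, inner ℝ (iterGrad x ℓ w t)
    (toEuclideanLin (pinv (gram (fun s => σ s + η s) (iterGrad x ℓ w) t)) (iterGrad x ℓ w t))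
  have h3 : P ≤ logTerm T (iterGrad x ℓ w) / κ := by
    rw [le_div_iff₀ hκ, mul_comm]; exact h2
  have h4 : regretTo x ℓ T w v ≤ ∑ t ∈ Finset.Icc 1 T,
      (inner ℝ (iterGrad x ℓ w t) (w t - v)
        - (σ t + η t) / 2 * inner ℝ (iterGrad x ℓ w t) (w t - v) ^ 2
        + 2 * (C * L) ^ 2 * η t) := by
    rw [regretTo, ← Finset.sum_sub_distrib]
    refine Finset.sum_le_sum fun t ht => ?_
    have hwt := hrun.mem_slab ht
    have h5 := hloss.curvature t ht (w t) hwt v hv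
    have h6 := abs_inner_iterGrad_le hloss ht hwt (mem_slab_of_mem_comparators hv ht)
    change _ + inner ℝ (iterGrad x ℓ w t) _ + _ * (inner ℝ (iterGrad x ℓ w t) _) ^ 2 ≤ _ at h5
    rw [← neg_sub (w t) v, inner_neg_right] at h5
    -- Half of this bound, η_t (2 C L)² / 2, is the penalty 2 (C L)² η_t.
    have h7 := mul_le_mul_of_nonneg_left (sq_le_sq.2 (h6.trans (le_abs_self _))) (hη t ht)
    linarith
  rw [Finset.sum_add_distrib, Finset.sum_sub_distrib, ← Finset.mul_sum] at h4
  have h8 : ∑ t ∈ Finset.Icc 1 T, (σ t + η t) / 2 * inner ℝ (iterGrad x ℓ w t) (w t - v) ^ 2 =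
      (∑ t ∈ Finset.Icc 1 T, (σ t + η t) * inner ℝ (iterGrad x ℓ w t) (w t - v) ^ 2) / 2 := by
    rw [Finset.sum_div]
    exact Finset.sum_congr rfl fun _ _ => by ring
  have h9 : 1 / (2 * κ) * logTerm T (iterGrad x ℓ w) = logTerm T (iterGrad x ℓ w) / κ / 2 := by
    field_simp
  linarith

/-- Telescopes 1/√(n+1) ≤ 2 (√(n+1) - √n). For a ≤ 0 every root is 0 by convention. -/
theorem sum_sqrt_div_le (a : ℝ) (T : ℕ) :
    ∑ t ∈ Finset.Icc 1 T, √(a / (t : ℝ)) ≤ 2 * √((T : ℝ) * a) := by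
  rcases le_or_gt a 0 with ha | ha
  · rw [Finset.sum_eq_zero fun t _ =>
      Real.sqrt_eq_zero_of_nonpos (div_nonpos_of_nonpos_of_nonneg ha t.cast_nonneg)]
    positivity
  induction T with
  | zero => simp
  | succ n ih =>
    rw [Finset.sum_Icc_succ_top (by omega)]
    have hn : (0 : ℝ) ≤ n := n.cast_nonneg
    push_cast
    rw [Real.sqrt_mul (by positivity)] at *
    rw [Real.sqrt_div ha.le]
    have h1 : √((n : ℝ) + 1) ^ 2 = n + 1 := Real.sq_sqrt (by positivity)
    have h2 : √(n : ℝ) ^ 2 = n := Real.sq_sqrt hn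
    have h3 : 0 < √((n : ℝ) + 1) := Real.sqrt_pos.2 (by positivity)
    have h4 : (√((n : ℝ) + 1))⁻¹ ≤ 2 * √((n : ℝ) + 1) - 2 * √(n : ℝ) := by
      rw [inv_le_iff_one_le_mul₀ h3]
      nlinarith [sq_nonneg (√((n : ℝ) + 1) - √(n : ℝ))]
    have h5 := mul_le_mul_of_nonneg_left h4 (Real.sqrt_nonneg a)
    rw [div_eq_mul_inv]
    linarith

theorem mainTheorem5 {d : ℕ} (T : ℕ) (C L : ℝ) (hC : 0 < C) (hL : 0 < L)
    (x : ℕ → EuclideanSpace ℝ (Fin d)) (ℓ : ℕ → ℝ → ℝ) (σ : ℕ → ℝ)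
    (hloss : LossAssumptions C L T x ℓ σ) :
    ((∀ t ∈ Finset.Icc 1 T, σ t = 0) →
      ∀ w : ℕ → EuclideanSpace ℝ (Fin d),
        IsInvariantRun C T x ℓ σ (fun t => 1 / (C * L) * √((d : ℝ) / (t : ℝ))) w →
        regret C x ℓ T w ≤
          ((C * L / 2 * √((T : ℝ) / (d : ℝ)) * logTerm T (iterGrad x ℓ w)
            + 4 * C * L * √((T : ℝ) * (d : ℝ)) : ℝ) : EReal)) ∧
    (∀ σ₀ : ℝ, 0 < σ₀ → (∀ t ∈ Finset.Icc 1 T, σ₀ ≤ σ t) →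
      ∀ w : ℕ → EuclideanSpace ℝ (Fin d),
        IsInvariantRun C T x ℓ σ (fun _ => 0) w →
        regret C x ℓ T w ≤
          ((1 / (2 * σ₀) * logTerm T (iterGrad x ℓ w) : ℝ) : EReal)) := by
  have hCL : 0 < C * L := mul_pos hC hL
  refine ⟨fun hσ w hrun => iSup₂_le fun v hv => EReal.coe_le_coe_iff.2 ?_,
    fun σ₀ hσ₀ hσ w hrun => iSup₂_le fun v hv => EReal.coe_le_coe_iff.2 ?_⟩
  · rcases Nat.eq_zero_or_pos d with rfl | hd
    -- In dimension 0 all vectors coincide, so the regret vanishes.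
    · have : regretTo x ℓ T w v = 0 := by
        rw [regretTo, Finset.sum_congr rfl fun t _ => by rw [Subsingleton.elim (w t) v], sub_self]
      simp [this]
    rcases Nat.eq_zero_or_pos T with rfl | hT
    · simp [regretTo]
    have hd' : (0 : ℝ) < d := by exact_mod_cast hd
    have hT' : (0 : ℝ) < T := by exact_mod_cast hT
    -- η decreases, so its last value η_T is the lower bound κ; it is positive because d and T are.
    refine (regretTo_le hloss (κ := 1 / (C * L) * √((d : ℝ) / (T : ℝ)))
      (fun t _ => by positivity) (by positivity) (fun t ht => ?_) hrun hv).trans ?_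
    · obtain ⟨h1, h2⟩ := Finset.mem_Icc.1 ht
      have h1' : (0 : ℝ) < t := by exact_mod_cast h1
      rw [hσ t ht, zero_add]
      gcongr
    · refine add_le_add (le_of_eq ?_) ?_
      · rw [← inv_div (d : ℝ) (T : ℝ), Real.sqrt_inv]
        have : √((d : ℝ) / (T : ℝ)) ≠ 0 := by positivity
        field_simp
      · rw [← Finset.mul_sum]
        calc 2 * (C * L) ^ 2 * (1 / (C * L) * ∑ t ∈ Finset.Icc 1 T, √((d : ℝ) / (t : ℝ)))
            = 2 * (C * L) * ∑ t ∈ Finset.Icc 1 T, √((d : ℝ) / (t : ℝ)) := by field_simp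
          _ ≤ 2 * (C * L) * (2 * √((T : ℝ) * d)) := by
              gcongr
              exact sum_sqrt_div_le _ T
          _ = _ := by ring
  · refine (regretTo_le hloss (κ := σ₀) (fun t _ => le_rfl) hσ₀
      (fun t ht => by simpa using hσ t ht) hrun hv).trans_eq ?_
    simp
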